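/- All digraphs are finite and simple (no loops, no multiple arcs). For a digraph $D$ on $n$ vertices let $A(D)$ be its adjacency matrix ($a_{ij}=1$ if $(i,j)$ is an arc and $a_{ij}=0$ otherwise), $\mathrm{diag}(D)$ the diagonal matrix of the outdegrees of its vertices, $Q(D)=\mathrm{diag}(D)+A(D)$ its signless Laplacian matrix, and $q(D)$ the spectral radius of $Q(D)$, i.e. the largest modulus of a complex eigenvalue of $Q(D)$. A clique of $D$ is a set of vertices any two distinct elements $u,v$ of which are joined by both arcs $(u,v)$ and $(v,u)$; the clique number of $D$ is the largest number of vertices of a clique. $D$ is strongly connected if for all vertices $u,v$ there is a directed path from $u$ to $v$. For $2\le d\le n-1$ let $B_{n,d}$ be the digraph with vertices $u_1,\dots,u_n$ whose arcs are all $(u_i,u_j)$ with $i\ne j$ and $u_i,u_j\in\{u_1,u_{n-d+2},u_{n-d+3},\dots,u_n\}$ (a complete digraph on $d$ vertices), together with the arcs $(u_i,u_{i+1})$, $1\le i\le n-d+1$, of the directed path $u_1u_2\cdots u_{n-d+2}$, which meets the complete digraph exactly in its two end vertices. **Theorem.** Let $2\le d\le n-1$ and let $D$ be a strongly connected digraph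 on $n$ vertices with clique number $d$. Then $q(D)\ge q(B_{n,d})$, with equality if and only if $D\cong B_{n,d}$. -/

import Mathlib

/-! Finite simple digraphs (`Digraph V` with `IsSimple`), strong connectivity, clique number,
the signless Laplacian spectral radius, and the digraph `B_{n,d}`. -/

namespace Digraph

/-- No loops. Multiple arcs cannot occur, as `Adj` is a relation. -/
def IsSimple {V : Type*} (D : Digraph V) : Prop := ∀ v, ¬ D.Adj v v

/-- Every vertex can be reached from every vertex along arcs. -/
def StronglyConnected {V : Type*} (D : Digraph V) : Prop :=
  ∀ u v, Relation.ReflTransGen D.Adj u v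

/-- `S` induces a complete subdigraph: any two distinct vertices of `S` are joined by arcs in both
directions. -/
def IsClique {V : Type*} (D : Digraph V) (S : Finset V) : Prop :=
  ∀ u ∈ S, ∀ v ∈ S, u ≠ v → D.Adj u v

open Classical in
/-- The clique number: the largest number of vertices of a clique. -/
noncomputable def cliqueNum {V : Type*} [Fintype V] (D : Digraph V) : ℕ :=
  (Finset.univ.filter fun S : Finset V => D.IsClique S).sup Finset.card

open Classical in
/-- The outdegree of a vertex. -/
noncomputable def outDegree {V : Type*} [Fintype V] (D : Digraph V) (v : V) : ℕ :=
  (Finset.univ.filter fun w => D.Adj v w).card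

open Classical in
/-- The adjacency matrix. -/
noncomputable def adjMatrix {V : Type*} (D : Digraph V) : Matrix V V ℝ :=
  Matrix.of fun v w => if D.Adj v w then 1 else 0

open Classical in
/-- The signless Laplacian matrix: diagonal matrix of outdegrees plus adjacency matrix. -/
noncomputable def signlessLaplacian {V : Type*} [Fintype V] (D : Digraph V) : Matrix V V ℝ :=
  Matrix.diagonal (fun v => (D.outDegree v : ℝ)) + D.adjMatrix

open Classical in
/-- The signless Laplacian spectral radius `q(D)`: the largest modulus of a complex eigenvalue of
the signless Laplacian matrix. -/
noncomputable def q {V : Type*} [Fintype V] (D : Digraph V) : ℝ :=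
  (spectralRadius ℂ (D.signlessLaplacian.map ((↑) : ℝ → ℂ))).toReal

open Classical in
/-- `q(D)` really is the maximum of the moduli of the complex eigenvalues. -/
theorem q_isGreatest {V : Type*} [Fintype V] [Nonempty V] (D : Digraph V) :
    IsGreatest {r : ℝ | ∃ k : ℂ, Module.End.HasEigenvalue
      (Matrix.toLin' (D.signlessLaplacian.map ((↑) : ℝ → ℂ))) k ∧ r = ‖k‖} D.q := by
  let _ := Matrix.linftyOpNormedRing (n := V) (α := ℂ)
  let _ := Matrix.linftyOpNormedAlgebra (n := V) (R := ℂ) (α := ℂ)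
  have hspec : ∀ k : ℂ, Module.End.HasEigenvalue
      (Matrix.toLin' (D.signlessLaplacian.map ((↑) : ℝ → ℂ))) k ↔
      k ∈ spectrum ℂ (D.signlessLaplacian.map ((↑) : ℝ → ℂ)) := fun k => by
    rw [Module.End.hasEigenvalue_iff_mem_spectrum, Matrix.spectrum_toLin']
  obtain ⟨k, hk, hkr⟩ := spectrum.exists_nnnorm_eq_spectralRadius
    (D.signlessLaplacian.map ((↑) : ℝ → ℂ))
  have hq : D.q = ‖k‖ := by
    rw [q, ← hkr]
    simp
  refine ⟨⟨k, (hspec k).2 hk, hq⟩, ?_⟩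
  rintro r ⟨l, hl, rfl⟩
  have h : (‖l‖₊ : ENNReal) ≤ ‖k‖₊ := by
    rw [hkr]
    exact le_iSup₂ (f := fun (m : ℂ)
      (_ : m ∈ spectrum ℂ (D.signlessLaplacian.map ((↑) : ℝ → ℂ))) => (‖m‖₊ : ENNReal))
      l ((hspec l).1 hl)
  rw [hq]
  exact_mod_cast h

/-- The digraph `B_{n,d}` (for `2 ≤ d ≤ n - 1`). The vertex `i : Fin n` plays the role of `u_{i+1}`.
The `d` vertices `u_1, u_{n-d+2}, u_{n-d+3}, …, u_n` span a complete digraph, and there is a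
directed path `u_1 u_2 ⋯ u_{n-d+2}` from the vertex `u_1` to the vertex `u_{n-d+2}`. -/
def B (n d : ℕ) : Digraph (Fin n) where
  Adj i j :=
    (i ≠ j ∧ (i.val = 0 ∨ n + 1 ≤ i.val + d) ∧ (j.val = 0 ∨ n + 1 ≤ j.val + d)) ∨
    (j.val = i.val + 1 ∧ j.val + d ≤ n + 1)

end Digraph

/-!
A nonnegative vector `x ≠ 0` with `r x ≤ Q(D) x` shows `r ≤ q(D)`, with strict inequality if `D` is
strongly connected and `r x ≠ Q(D) x`; a positive vector with `Q(D) x ≤ r x` shows `q(D) ≤ r`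
(`Digraph.le_q`, `Digraph.lt_q`, `Digraph.q_le`). So it suffices to transplant the Perron vector of
`B_{n,d}` to `D`.

Let `m = n - d`, let `ρ = t + 1` be the root of `(ρ - d) (ρ - 2 d + 3) = d - 1 + t ^ (-m)` with
`ρ > 2 d - 2`, and let `z = ρ - 2 d + 3 > 1`. Take a clique `K` of `D` with `d` vertices and an arc
`w → v₁` leaving it. The test vector is `z` at `w` and `t ^ (-h v)` at every other vertex `v`, where
`h v` is the distance from `v` to `K`. The row of `Q(D) x` at `v` is the sum of `x v + x u` over the
out-neighbours `u` of `v`. At a clique vertex other than `w` the clique alone contributes `ρ x v`; at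
`w` the clique and `v₁` contribute at least `ρ z`, since the distance of `v₁` is at most `m`; at a
vertex outside `K` an arc that lowers the distance contributes at least `ρ x v`. Thus `ρ x ≤ Q(D) x`
(`Digraph.CliqueLayering.smul_testVec_le`).

Equality in all rows says that `D` has no further arcs, that `v₁` has distance `m`, and that no arc
enters `K` at `w`, because `z > 1` (`Digraph.CliqueLayering.isTight_of_mulVec_testVec`). The `m`
vertices outside `K` then have the distinct distances `1, …, m` and form a path, so `D` is
`B_{n,d}` (`Digraph.IsTight.nonempty_relIso`). Conversely `B_{n,d}` is of this form, so that `x` is a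
positive eigenvector for it and `q(B_{n,d}) = ρ`.
-/

/-! ### Collatz–Wielandt bounds for nonnegative matrices -/

open Matrix in
theorem Matrix.pow_smul_le_pow_mulVec {V : Type*} [Fintype V] [DecidableEq V] {A : Matrix V V ℝ}
    (hA : ∀ i j, 0 ≤ A i j) {x : V → ℝ} {r : ℝ} (hr : 0 ≤ r) (h : r • x ≤ A *ᵥ x) (k : ℕ) :
    r ^ k • x ≤ (A ^ k) *ᵥ x := by
  induction k with
  | zero => simp
  | succ k ih =>
    calc r ^ (k + 1) • x = r ^ k • (r • x) := by rw [smul_smul, pow_succ]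
      _ ≤ r ^ k • (A *ᵥ x) := smul_le_smul_of_nonneg_left h (pow_nonneg hr k)
      _ = A *ᵥ (r ^ k • x) := (mulVec_smul A (r ^ k) x).symm
      _ ≤ A *ᵥ (A ^ k *ᵥ x) := fun i =>
          Finset.sum_le_sum fun j _ => mul_le_mul_of_nonneg_left (ih j) (hA i j)
      _ = (A ^ (k + 1)) *ᵥ x := by rw [mulVec_mulVec, ← pow_succ']

open Matrix in
/-- The lower Collatz–Wielandt bound. Iterating gives `r ^ k • x ≤ A ^ k *ᵥ x`, hence
`r ^ k ≤ ‖A ^ k‖`, and Gelfand's formula applies. -/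
theorem Matrix.ofReal_le_spectralRadius {V : Type*} [Fintype V] [DecidableEq V]
    {A : Matrix V V ℝ} (hA : ∀ i j, 0 ≤ A i j) {x : V → ℝ} (hx : 0 ≤ x) (hx0 : x ≠ 0)
    {r : ℝ} (hr : 0 ≤ r) (h : r • x ≤ A *ᵥ x) :
    ENNReal.ofReal r ≤ spectralRadius ℂ (A.map ((↑) : ℝ → ℂ)) := by
  let _ := Matrix.linftyOpNormedRing (n := V) (α := ℂ)
  let _ := Matrix.linftyOpNormedAlgebra (n := V) (R := ℂ) (α := ℂ)
  obtain ⟨i₀, hi₀⟩ := Function.ne_iff.1 hx0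
  have : Nonempty V := ⟨i₀⟩
  obtain ⟨i, hi⟩ := Finite.exists_max x
  have hxi : 0 < x i := lt_of_lt_of_le (lt_of_le_of_ne (hx i₀) (Ne.symm hi₀)) (hi i₀)
  set M : Matrix V V ℂ := A.map ((↑) : ℝ → ℂ) with hM
  have hpow : ∀ k, r ^ k ≤ ‖M ^ k‖ := by
    intro k
    have hMk : M ^ k = (A ^ k).map ((↑) : ℝ → ℂ) := by
      have := (map_pow (Complex.ofRealHom.mapMatrix (m := V)) A k).symm
      exact this
    let y : V → ℂ := fun j => (x j : ℂ)
    have hy : ‖y‖ ≤ x i := (pi_norm_le_iff_of_nonneg hxi.le).2 fun j => by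
      simpa [y, abs_of_nonneg (hx j)] using hi j
    have hMy : (M ^ k *ᵥ y) i = (((A ^ k) *ᵥ x) i : ℝ) := by
      simp [hMk, y, mulVec, dotProduct]
    have h1 : r ^ k * x i ≤ ‖M ^ k‖ * x i :=
      calc r ^ k * x i ≤ ((A ^ k) *ᵥ x) i := pow_smul_le_pow_mulVec hA hr h k i
        _ ≤ ‖(M ^ k *ᵥ y) i‖ := by
            rw [hMy, Complex.norm_real]; exact le_abs_self _
        _ ≤ ‖M ^ k *ᵥ y‖ := norm_le_pi_norm _ i
        _ ≤ ‖M ^ k‖ * ‖y‖ := Matrix.linfty_opNorm_mulVec _ _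
        _ ≤ ‖M ^ k‖ * x i := mul_le_mul_of_nonneg_left hy (norm_nonneg _)
    exact le_of_mul_le_mul_right h1 hxi
  refine ge_of_tendsto (spectrum.pow_norm_pow_one_div_tendsto_nhds_spectralRadius M) ?_
  filter_upwards [Filter.eventually_gt_atTop 0] with k hk
  apply ENNReal.ofReal_le_ofReal
  calc r = (r ^ k) ^ (1 / k : ℝ) := by
        rw [one_div, Real.pow_rpow_inv_natCast hr hk.ne']
    _ ≤ _ := Real.rpow_le_rpow (pow_nonneg hr k) (hpow k) (by positivity)

open Matrix in
/-- A nonzero vector `z ≥ 0` becomes positive under a high power of a nonnegative irreducible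
matrix with positive diagonal: the support never shrinks, and it spreads along the arcs. -/
theorem Matrix.exists_pow_mulVec_pos {V : Type*} [Fintype V] [DecidableEq V]
    {A : Matrix V V ℝ} (hA : ∀ i j, 0 ≤ A i j) (hdiag : ∀ i, 0 < A i i)
    (hirr : ∀ i j, Relation.ReflTransGen (fun a b => 0 < A a b) i j)
    {z : V → ℝ} (hz : 0 ≤ z) (hz0 : z ≠ 0) : ∃ N, ∀ i, 0 < ((A ^ N) *ᵥ z) i := by
  have hnn : ∀ k, 0 ≤ (A ^ k) *ᵥ z := by
    intro k
    induction k with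
    | zero => simpa using hz
    | succ k ih =>
      rw [pow_succ', ← mulVec_mulVec]
      exact fun i => Finset.sum_nonneg fun j _ => mul_nonneg (hA i j) (ih j)
  have step : ∀ k i j, 0 < A i j → 0 < ((A ^ k) *ᵥ z) j → 0 < ((A ^ (k + 1)) *ᵥ z) i := by
    intro k i j hij hj
    rw [pow_succ', ← mulVec_mulVec]
    exact Finset.sum_pos' (fun l _ => mul_nonneg (hA i l) (hnn k l))
      ⟨j, Finset.mem_univ j, mul_pos hij hj⟩
  have mono : ∀ i k l, k ≤ l → 0 < ((A ^ k) *ᵥ z) i → 0 < ((A ^ l) *ᵥ z) i := by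
    intro i k l hkl hk
    induction l, hkl using Nat.le_induction with
    | base => exact hk
    | succ l _ ih => exact step l i i (hdiag i) ih
  obtain ⟨v, hv⟩ := Function.ne_iff.1 hz0
  have hv : 0 < z v := lt_of_le_of_ne (hz v) (Ne.symm hv)
  have hreach : ∀ i, ∃ k, 0 < ((A ^ k) *ᵥ z) i := by
    intro i
    induction hirr i v using Relation.ReflTransGen.head_induction_on with
    | refl => exact ⟨0, by simpa using hv⟩
    | head hab _ ih =>
      obtain ⟨k, hk⟩ := ih
      exact ⟨k + 1, step k _ _ hab hk⟩
  choose k hk using hreach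
  exact ⟨Finset.univ.sup k, fun i => mono i _ _ (Finset.le_sup (Finset.mem_univ i)) (hk i)⟩

open Matrix in
/-- The strict form of the lower Collatz–Wielandt bound for irreducible matrices: a high power of
`A` turns the nonzero excess `A *ᵥ x - r • x` into a positive vector, which leaves room to
enlarge `r`. -/
theorem Matrix.exists_gt_smul_le_mulVec {V : Type*} [Fintype V] [DecidableEq V]
    {A : Matrix V V ℝ} (hA : ∀ i j, 0 ≤ A i j) (hdiag : ∀ i, 0 < A i i)
    (hirr : ∀ i j, Relation.ReflTransGen (fun a b => 0 < A a b) i j)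
    {x : V → ℝ} (hx : 0 ≤ x) (hx0 : x ≠ 0) {r : ℝ} (h : r • x ≤ A *ᵥ x)
    (hne : A *ᵥ x ≠ r • x) :
    ∃ s > r, ∃ y : V → ℝ, 0 ≤ y ∧ y ≠ 0 ∧ s • y ≤ A *ᵥ y := by
  obtain ⟨v, -⟩ := Function.ne_iff.1 hx0
  have : Nonempty V := ⟨v⟩
  obtain ⟨N, hN⟩ := exists_pow_mulVec_pos hA hdiag hirr (sub_nonneg.2 h) (sub_ne_zero.2 hne)
  have hnn : 0 ≤ (A ^ N) *ᵥ x := by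
    have := pow_smul_le_pow_mulVec hA le_rfl
      (x := x) (by
        rw [zero_smul]
        exact fun i => Finset.sum_nonneg fun j _ => mul_nonneg (hA i j) (hx j)) N
    exact le_trans (smul_nonneg (pow_nonneg le_rfl N) hx) this
  set y := (A ^ N) *ᵥ x with hy
  have hexc : ∀ i, r * y i < (A *ᵥ y) i := by
    intro i
    have h1 := hN i
    have h2 : (A ^ N) *ᵥ (A *ᵥ x - r • x) = A *ᵥ y - r • y := by
      rw [mulVec_sub, mulVec_smul, mulVec_mulVec, hy, mulVec_mulVec, ← pow_succ, ← pow_succ']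
    rw [h2] at h1
    simpa using h1
  -- `c` bounds `y`, and `e` bounds the excess from below, so `r` may grow by `e / (c + 1)`.
  obtain ⟨i, hi⟩ := Finite.exists_max y
  obtain ⟨j, hj⟩ := Finite.exists_min fun i => (A *ᵥ y) i - r * y i
  have hc : 0 < y i + 1 := by have := hnn i; simp at this; linarith
  have he : 0 < (A *ᵥ y) j - r * y j := sub_pos.2 (hexc j)
  refine ⟨r + ((A *ᵥ y) j - r * y j) / (y i + 1), by
    have := div_pos he hc; linarith, y, hnn, ?_, ?_⟩
  · intro h0
    have := hexc v
    simp [h0] at this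
  · intro l
    have h1 : ((A *ᵥ y) j - r * y j) / (y i + 1) * y l ≤ (A *ᵥ y) j - r * y j := by
      rw [div_mul_eq_mul_div, div_le_iff₀ hc]
      exact mul_le_mul_of_nonneg_left (by linarith [hi l]) he.le
    have h2 := hj l
    simp only [Pi.smul_apply, smul_eq_mul, add_mul]
    linarith

namespace Digraph

open Matrix

/-! ### The signless Laplacian -/

section Spectral

variable {V : Type*} [Fintype V]

open Classical in
/-- The out-neighbourhood of a vertex. -/
noncomputable def outNbrs (D : Digraph V) (v : V) : Finset V := Finset.univ.filter (D.Adj v)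

@[simp]
theorem mem_outNbrs (D : Digraph V) {v w : V} : w ∈ D.outNbrs v ↔ D.Adj v w := by
  simp [outNbrs]

open Classical in
theorem signlessLaplacian_mulVec (D : Digraph V) (x : V → ℝ) (v : V) :
    (D.signlessLaplacian *ᵥ x) v = ∑ w ∈ D.outNbrs v, (x v + x w) := by
  rw [signlessLaplacian, add_mulVec, Pi.add_apply, mulVec_diagonal, Finset.sum_add_distrib,
    Finset.sum_const, nsmul_eq_mul]
  congr 1
  simp [mulVec, dotProduct, adjMatrix, outNbrs, Finset.sum_filter]

theorem signlessLaplacian_nonneg (D : Digraph V) (i j : V) : 0 ≤ D.signlessLaplacian i j := by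
  classical
  simp only [signlessLaplacian, adjMatrix, Matrix.add_apply, Matrix.diagonal_apply, of_apply]
  split_ifs <;> positivity

theorem signlessLaplacian_pos_of_adj (D : Digraph V) {i j : V} (h : D.Adj i j) :
    0 < D.signlessLaplacian i j := by
  classical
  simp only [signlessLaplacian, adjMatrix, Matrix.add_apply, Matrix.diagonal_apply, of_apply, h]
  split_ifs <;> positivity

theorem signlessLaplacian_diag_pos (D : Digraph V) {i j : V} (h : D.Adj i j) :
    0 < D.signlessLaplacian i i := by
  classical
  have h1 : 0 < D.outDegree i := Finset.card_pos.2 ⟨j, by simpa using h⟩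
  simp only [signlessLaplacian, adjMatrix, Matrix.add_apply, Matrix.diagonal_apply, of_apply]
  split_ifs <;> positivity

open Classical in
theorem spectralRadius_signlessLaplacian_ne_top (D : Digraph V) :
    spectralRadius ℂ (D.signlessLaplacian.map ((↑) : ℝ → ℂ)) ≠ ⊤ := by
  cases isEmpty_or_nonempty V
  · rw [spectrum.SpectralRadius.of_subsingleton]; simp
  let _ := Matrix.linftyOpNormedRing (n := V) (α := ℂ)
  let _ := Matrix.linftyOpNormedAlgebra (n := V) (R := ℂ) (α := ℂ)
  exact ne_top_of_le_ne_top ENNReal.coe_ne_top (spectrum.spectralRadius_le_nnnorm _)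

theorem le_q (D : Digraph V) {x : V → ℝ} (hx : 0 ≤ x) (hx0 : x ≠ 0) {r : ℝ} (hr : 0 ≤ r)
    (h : r • x ≤ D.signlessLaplacian *ᵥ x) : r ≤ D.q := by
  classical
  have := Matrix.ofReal_le_spectralRadius D.signlessLaplacian_nonneg hx hx0 hr h
  rw [ENNReal.ofReal_le_iff_le_toReal (by convert D.spectralRadius_signlessLaplacian_ne_top)]
    at this
  unfold q
  convert this

/-- Strict lower bound. Strong connectivity makes `Q(D)` irreducible, and the diagonal, being the
outdegrees, is positive. -/
theorem lt_q (D : Digraph V) (hconn : D.StronglyConnected) (hout : ∀ v, ∃ w, D.Adj v w)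
    {x : V → ℝ} (hx : 0 ≤ x) (hx0 : x ≠ 0) {r : ℝ} (hr : 0 ≤ r)
    (h : r • x ≤ D.signlessLaplacian *ᵥ x) (hne : D.signlessLaplacian *ᵥ x ≠ r • x) :
    r < D.q := by
  classical
  obtain ⟨s, hs, y, hy, hy0, hsy⟩ := Matrix.exists_gt_smul_le_mulVec D.signlessLaplacian_nonneg
    (fun i => D.signlessLaplacian_diag_pos (hout i).choose_spec)
    (fun i j => Relation.ReflTransGen.mono (fun _ _ => D.signlessLaplacian_pos_of_adj) i j (hconn i j)) hx hx0 h hne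
  exact hs.trans_le (D.le_q hy hy0 (hr.trans hs.le) hsy)

/-- The upper Collatz–Wielandt bound: compare a complex eigenvector `u` with the positive vector `x`
at a vertex where `‖u i‖ / x i` is largest. -/
theorem q_le [Nonempty V] (D : Digraph V) {x : V → ℝ} (hx : ∀ i, 0 < x i) {r : ℝ}
    (h : D.signlessLaplacian *ᵥ x ≤ r • x) : D.q ≤ r := by
  classical
  obtain ⟨k, hk, hq⟩ := D.q_isGreatest.1
  obtain ⟨u, hu⟩ := hk.exists_hasEigenvector
  have hku := hu.apply_eq_smul
  have hu0 := hu.2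
  obtain ⟨i, hi⟩ := Finite.exists_max fun i => ‖u i‖ / x i
  set c := ‖u i‖ / x i with hc
  have hui : ∀ j, ‖u j‖ ≤ c * x j := fun j => (div_le_iff₀ (hx j)).1 (hi j)
  have hcx : ‖u i‖ = c * x i := by rw [hc, div_mul_cancel₀ _ (hx i).ne']
  have hcpos : 0 < c := by
    obtain ⟨j, hj⟩ := Function.ne_iff.1 hu0
    exact lt_of_lt_of_le (div_pos (norm_pos_iff.2 hj) (hx j)) (hi j)
  have h1 : ‖k‖ * (c * x i) ≤ r * (c * x i) :=
    calc ‖k‖ * (c * x i) = ‖(k • u) i‖ := by simp [hcx]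
      _ = ‖∑ j, (D.signlessLaplacian i j : ℂ) * u j‖ := by
          rw [← hku]; simp [toLin'_apply, mulVec, dotProduct]
      _ ≤ ∑ j, D.signlessLaplacian i j * (c * x j) := by
          refine norm_sum_le_of_le _ fun j _ => ?_
          rw [norm_mul, Complex.norm_real, Real.norm_of_nonneg (D.signlessLaplacian_nonneg i j)]
          exact mul_le_mul_of_nonneg_left (hui j) (D.signlessLaplacian_nonneg i j)
      _ = c * (D.signlessLaplacian *ᵥ x) i := by
          simp only [mulVec, dotProduct, Finset.mul_sum]
          exact Finset.sum_congr rfl fun j _ => by ring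
      _ ≤ c * (r * x i) := mul_le_mul_of_nonneg_left (h i) hcpos.le
      _ = r * (c * x i) := by ring
  rw [hq]
  exact le_of_mul_le_mul_right h1 (mul_pos hcpos (hx i))

theorem q_eq_of_relIso {W : Type*} [Fintype W] {D : Digraph V} {E : Digraph W}
    (e : D.Adj ≃r E.Adj) : D.q = E.q := by
  classical
  have hdeg : ∀ v, D.outDegree v = E.outDegree (e v) := fun v => by
    unfold outDegree
    refine Finset.card_bij (fun w _ => e w) (fun w hw => ?_) (fun _ _ _ _ h => e.injective h)
      fun w hw => ⟨e.symm w, ?_, by simp⟩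
    · simpa [e.map_rel_iff] using hw
    · simpa [← e.map_rel_iff] using hw
  have hM : E.signlessLaplacian.map ((↑) : ℝ → ℂ) =
      Matrix.reindexAlgEquiv ℂ ℂ e.toEquiv (D.signlessLaplacian.map ((↑) : ℝ → ℂ)) := by
    ext i j
    obtain ⟨i, rfl⟩ := e.toEquiv.surjective i
    obtain ⟨j, rfl⟩ := e.toEquiv.surjective j
    simp only [signlessLaplacian, adjMatrix, map_apply, Matrix.add_apply, diagonal_apply, of_apply,
      coe_reindexAlgEquiv, reindex_apply, submatrix_apply, Equiv.symm_apply_apply, hdeg]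
    simp only [EmbeddingLike.apply_eq_iff_eq, RelIso.coe_fn_toEquiv, e.map_rel_iff]
  have := AlgEquiv.spectrum_eq (Matrix.reindexAlgEquiv ℂ ℂ e.toEquiv)
    (D.signlessLaplacian.map ((↑) : ℝ → ℂ))
  rw [← hM] at this
  have h2 : spectralRadius ℂ (E.signlessLaplacian.map ((↑) : ℝ → ℂ)) =
      spectralRadius ℂ (D.signlessLaplacian.map ((↑) : ℝ → ℂ)) := by
    unfold spectralRadius
    rw [this]
  unfold q
  convert congrArg ENNReal.toReal h2.symm

end Spectral

/-! ### Clique layerings and the test vector -/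

section Layering

variable {V : Type*}

/-- A clique `K` of `D`, an arc `w → v₁` leaving it, and a function `h` which is `0` exactly on `K`
and drops by one along some arc out of every other vertex, as the distance to `K` does. -/
structure CliqueLayering (D : Digraph V) (K : Finset V) (w v₁ : V) (h : V → ℕ) : Prop where
  isClique : D.IsClique K
  mem : w ∈ K
  notMem : v₁ ∉ K
  adj : D.Adj w v₁
  eq_zero_iff : ∀ v, h v = 0 ↔ v ∈ K
  exists_adj : ∀ v ∉ K, ∃ s, D.Adj v s ∧ h s + 1 = h v

open Classical in
/-- A clique layering is tight when `D` has no arcs beyond those it provides, `v₁` has height `m`,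
and no arc enters `K` at `w`. With `m` vertices outside `K` this describes `B_{n,d}`. -/
structure IsTight [Fintype V] (D : Digraph V) (K : Finset V) (w v₁ : V) (h : V → ℕ) (m : ℕ) :
    Prop where
  outNbrs_of_mem : ∀ v ∈ K, v ≠ w → D.outNbrs v = K.erase v
  outNbrs_exit : D.outNbrs w = insert v₁ (K.erase w)
  height_exit : h v₁ = m
  outNbrs_of_notMem : ∀ v ∉ K, ∃ s, s ≠ w ∧ h s + 1 = h v ∧ D.outNbrs v = {s}

open Classical in
/-- The value `z` at the exit vertex `w`, and `t ^ (-h v)` at every other vertex `v`. -/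
noncomputable def testVec (t z : ℝ) (w : V) (h : V → ℕ) (v : V) : ℝ :=
  if v = w then z else (t ^ h v)⁻¹

theorem testVec_self (t z : ℝ) (w : V) (h : V → ℕ) : testVec t z w h w = z := by simp [testVec]

theorem testVec_of_ne (t z : ℝ) (h : V → ℕ) {v w : V} (hv : v ≠ w) :
    testVec t z w h v = (t ^ h v)⁻¹ := by simp [testVec, hv]

theorem testVec_pos {t z : ℝ} (ht : 0 < t) (hz : 0 < z) (w : V) (h : V → ℕ) (v : V) :
    0 < testVec t z w h v := by
  unfold testVec; split_ifs <;> positivity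

/-- For `ρ = t + 1`, this is the characteristic equation `(ρ - d) (ρ - 2 d + 3) = d - 1 + t ^ (-m)`
of `B_{n,d}` with `m = n - d`. The lower bound for `t` says that `ρ > 2 d - 2`, so that the value
`z = ρ - 2 d + 3 = t + 4 - 2 d` at the exit vertex exceeds `1`. -/
theorem exists_root (d m : ℕ) (hd : 2 ≤ d) : ∃ t : ℝ, 2 * d - 3 < t ∧
    (t + 1 - d) * (t + 4 - 2 * d) = d - 1 + (t ^ m)⁻¹ := by
  have hd' : (2 : ℝ) ≤ d := by exact_mod_cast hd
  set f : ℝ → ℝ := fun t => (t + 1 - d) * (t + 4 - 2 * d) - (d - 1) - (t ^ m)⁻¹ with hf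
  have hcont : ContinuousOn f (Set.Icc (2 * d - 3 : ℝ) (2 * d)) := by
    refine ContinuousOn.sub (by fun_prop) (ContinuousOn.inv₀ (by fun_prop) fun t ht => ?_)
    exact pow_ne_zero _ (by linarith [ht.1])
  have hpos : 0 < ((2 * d - 3 : ℝ) ^ m)⁻¹ := inv_pos.2 (pow_pos (by linarith) m)
  have hle : ((2 * d : ℝ) ^ m)⁻¹ ≤ 1 := inv_le_one_of_one_le₀ (one_le_pow₀ (by linarith))
  obtain ⟨t, ht, hft⟩ := intermediate_value_Ioo (by linarith) hcont
    (show (0 : ℝ) ∈ Set.Ioo _ _ from ⟨by simp only [hf]; nlinarith, by simp only [hf]; nlinarith⟩)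
  exact ⟨t, ht.1, by simp only [hf] at hft; linarith⟩

variable {D : Digraph V} {K : Finset V} {w v₁ : V} {h : V → ℕ} {d m : ℕ} {t : ℝ}

open Classical in
theorem sum_testVec_of_mem (hw : w ∈ K) (h0 : ∀ v, h v = 0 ↔ v ∈ K) (hK : K.card = d)
    {v : V} (hv : v ∈ K) (hvw : v ≠ w) :
    ∑ u ∈ K.erase v, (testVec t (t + 4 - 2 * d) w h v + testVec t (t + 4 - 2 * d) w h u) =
      (t + 1) * testVec t (t + 4 - 2 * d) w h v := by
  have hval : ∀ u ∈ K, u ≠ w → testVec t (t + 4 - 2 * d) w h u = 1 := fun u hu huw => by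
    rw [testVec_of_ne _ _ _ huw, (h0 u).2 hu]; simp
  have hwv : w ∈ K.erase v := Finset.mem_erase.2 ⟨hvw.symm, hw⟩
  have hcard : (((K.erase v).erase w).card : ℝ) + 2 = d := by
    have h1 := Finset.card_erase_add_one hv
    have h2 := Finset.card_erase_add_one hwv
    rw [← hK]; exact_mod_cast (by omega)
  rw [← Finset.add_sum_erase _ _ hwv, testVec_self, hval v hv hvw,
    Finset.sum_congr rfl fun u hu => by
      rw [hval u (Finset.mem_of_mem_erase (Finset.mem_of_mem_erase hu)) (Finset.ne_of_mem_erase hu)],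
    Finset.sum_const, nsmul_eq_mul]
  linarith

open Classical in
theorem sum_testVec_exit (hw : w ∈ K) (hv₁ : v₁ ∉ K) (h0 : ∀ v, h v = 0 ↔ v ∈ K)
    (hK : K.card = d) (ht : (t + 1 - d) * (t + 4 - 2 * d) = d - 1 + (t ^ m)⁻¹) :
    ∑ u ∈ insert v₁ (K.erase w),
        (testVec t (t + 4 - 2 * d) w h w + testVec t (t + 4 - 2 * d) w h u) =
      (t + 1) * testVec t (t + 4 - 2 * d) w h w + ((t ^ h v₁)⁻¹ - (t ^ m)⁻¹) := by
  have hval : ∀ u ∈ K.erase w, testVec t (t + 4 - 2 * d) w h u = 1 := fun u hu => by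
    rw [testVec_of_ne _ _ _ (Finset.ne_of_mem_erase hu), (h0 u).2 (Finset.mem_of_mem_erase hu)]
    simp
  have hcard : ((K.erase w).card : ℝ) + 1 = d := by
    have h1 := Finset.card_erase_add_one hw
    rw [← hK]; exact_mod_cast h1
  rw [Finset.sum_insert fun h' => hv₁ (Finset.mem_of_mem_erase h'), testVec_self,
    testVec_of_ne t _ h (show v₁ ≠ w from fun h' => hv₁ (h' ▸ hw)),
    Finset.sum_congr rfl fun u hu => by rw [hval u hu], Finset.sum_const, nsmul_eq_mul]
  have : ((K.erase w).card : ℝ) = d - 1 := by linarith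
  rw [this]
  linarith

theorem testVec_add_of_ne (ht : 0 < t) {z : ℝ} {v s : V} (hvw : v ≠ w) (hsw : s ≠ w)
    (hs : h s + 1 = h v) :
    testVec t z w h v + testVec t z w h s = (t + 1) * testVec t z w h v := by
  rw [testVec_of_ne _ _ _ hvw, testVec_of_ne _ _ _ hsw, ← hs, pow_succ]
  field_simp
  ring

theorem testVec_add_exit (ht : 0 < t) {z : ℝ} (hz : 1 < z) {v : V} (hvw : v ≠ w) (hw : h w = 0)
    (hs : h w + 1 = h v) :
    (t + 1) * testVec t z w h v < testVec t z w h v + testVec t z w h w := by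
  rw [testVec_of_ne _ _ _ hvw, testVec_self, ← hs, hw]
  have : t * t⁻¹ = 1 := mul_inv_cancel₀ ht.ne'
  simp only [zero_add, pow_one]
  linarith

namespace CliqueLayering

theorem ne_of_notMem (L : D.CliqueLayering K w v₁ h) {v : V} (hv : v ∉ K) : v ≠ w :=
  fun h' => hv (h' ▸ L.mem)

/-- Every height between `1` and `h v` is attained, outside `K`, as the heights drop by one along
arcs. -/
theorem exists_height_eq (L : D.CliqueLayering K w v₁ h) (v : V) :
    ∀ k, 1 ≤ k → k ≤ h v → ∃ u ∉ K, h u = k := by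
  induction hv : h v using Nat.strong_induction_on generalizing v with
  | _ l ih =>
    intro k hk hkl
    have hvK : v ∉ K := fun h' => by have := (L.eq_zero_iff v).2 h'; omega
    obtain rfl | hlt := hkl.eq_or_lt
    · exact ⟨v, hvK, hv⟩
    · obtain ⟨s, -, hs⟩ := L.exists_adj v hvK
      exact ih (h s) (by omega) s rfl k hk (by omega)

end CliqueLayering

variable [Fintype V]

open Classical in
/-- A set of out-neighbours whose contribution to the row of `Q(D) x` at `v` already reaches `c`
contains all out-neighbours if that row equals `c`. -/
theorem outNbrs_eq_of_le_sum {x : V → ℝ} (hx : ∀ v, 0 < x v) {v : V} {S : Finset V}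
    (hS : S ⊆ D.outNbrs v) {c : ℝ} (hc : c ≤ ∑ u ∈ S, (x v + x u))
    (heq : ∑ u ∈ D.outNbrs v, (x v + x u) = c) :
    D.outNbrs v = S ∧ ∑ u ∈ S, (x v + x u) = c := by
  have hSN : D.outNbrs v = S := by
    by_contra hne
    obtain ⟨u, hu, huS⟩ := Finset.exists_of_ssubset (lt_of_le_of_ne hS (Ne.symm hne))
    have := Finset.sum_lt_sum_of_subset (f := fun u => x v + x u) hS hu huS
      (add_pos (hx v) (hx u)) fun j _ _ => (add_pos (hx v) (hx j)).le
    linarith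
  exact ⟨hSN, hSN ▸ heq⟩

namespace CliqueLayering

theorem erase_subset_outNbrs [DecidableEq V] (L : D.CliqueLayering K w v₁ h) {v : V}
    (hv : v ∈ K) : K.erase v ⊆ D.outNbrs v :=
  fun u hu => D.mem_outNbrs.2
    (L.isClique v hv u (Finset.mem_of_mem_erase hu) (Finset.ne_of_mem_erase hu).symm)

theorem insert_subset_outNbrs [DecidableEq V] (L : D.CliqueLayering K w v₁ h) :
    insert v₁ (K.erase w) ⊆ D.outNbrs w :=
  Finset.insert_subset (D.mem_outNbrs.2 L.adj) (L.erase_subset_outNbrs L.mem)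

/-- The out-neighbours provided by a clique layering suffice for each row of `ρ x ≤ Q(D) x`, where
`ρ = t + 1`. -/
theorem exists_subset_le_sum (L : D.CliqueLayering K w v₁ h) (hK : K.card = d) (hm : h v₁ ≤ m)
    (ht1 : 1 < t) (htd : 2 * d - 3 < t)
    (ht : (t + 1 - d) * (t + 4 - 2 * d) = d - 1 + (t ^ m)⁻¹) (v : V) :
    ∃ S ⊆ D.outNbrs v, (t + 1) * testVec t (t + 4 - 2 * d) w h v ≤
      ∑ u ∈ S, (testVec t (t + 4 - 2 * d) w h v + testVec t (t + 4 - 2 * d) w h u) := by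
  classical
  by_cases hv : v ∈ K
  · by_cases hvw : v = w
    · subst hvw
      refine ⟨_, L.insert_subset_outNbrs, ?_⟩
      rw [sum_testVec_exit L.mem L.notMem L.eq_zero_iff hK ht]
      have := inv_anti₀ (by positivity) (pow_le_pow_right₀ ht1.le hm)
      linarith
    · exact ⟨_, L.erase_subset_outNbrs hv, (sum_testVec_of_mem L.mem L.eq_zero_iff hK hv hvw).ge⟩
  · obtain ⟨s, hvs, hs⟩ := L.exists_adj v hv
    refine ⟨{s}, by simpa using hvs, ?_⟩
    rw [Finset.sum_singleton]
    by_cases hsw : s = w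
    · subst hsw
      exact (testVec_add_exit (by linarith) (by linarith) (L.ne_of_notMem hv)
        ((L.eq_zero_iff _).2 L.mem) hs).le
    · exact (testVec_add_of_ne (by linarith) (L.ne_of_notMem hv) hsw hs).ge

theorem smul_testVec_le (L : D.CliqueLayering K w v₁ h) (hK : K.card = d) (hm : h v₁ ≤ m)
    (ht1 : 1 < t) (htd : 2 * d - 3 < t)
    (ht : (t + 1 - d) * (t + 4 - 2 * d) = d - 1 + (t ^ m)⁻¹) :
    (t + 1) • testVec t (t + 4 - 2 * d) w h ≤
      D.signlessLaplacian *ᵥ testVec t (t + 4 - 2 * d) w h := by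
  intro v
  obtain ⟨S, hS, hle⟩ := L.exists_subset_le_sum hK hm ht1 htd ht v
  rw [signlessLaplacian_mulVec]
  exact hle.trans (Finset.sum_le_sum_of_subset_of_nonneg hS fun u _ _ =>
    (add_pos (testVec_pos (by linarith) (by linarith) w h v)
      (testVec_pos (by linarith) (by linarith) w h u)).le)

theorem mulVec_testVec_of_isTight (L : D.CliqueLayering K w v₁ h) (T : D.IsTight K w v₁ h m)
    (hK : K.card = d) (ht0 : 0 < t)
    (ht : (t + 1 - d) * (t + 4 - 2 * d) = d - 1 + (t ^ m)⁻¹) :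
    D.signlessLaplacian *ᵥ testVec t (t + 4 - 2 * d) w h =
      (t + 1) • testVec t (t + 4 - 2 * d) w h := by
  classical
  ext v
  rw [signlessLaplacian_mulVec, Pi.smul_apply, smul_eq_mul]
  by_cases hv : v ∈ K
  · by_cases hvw : v = w
    · subst hvw
      rw [T.outNbrs_exit]
      convert sum_testVec_exit L.mem L.notMem L.eq_zero_iff hK ht using 1
      rw [T.height_exit]; ring
    · rw [T.outNbrs_of_mem v hv hvw]
      convert sum_testVec_of_mem L.mem L.eq_zero_iff hK hv hvw
  · obtain ⟨s, hsw, hs, hN⟩ := T.outNbrs_of_notMem v hv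
    rw [hN, Finset.sum_singleton]
    exact testVec_add_of_ne ht0 (L.ne_of_notMem hv) hsw hs

/-- Equality in every row forces all out-neighbourhoods, the height of `v₁`, and that no arc
enters `K` at `w`, where the test vector exceeds `1`. -/
theorem isTight_of_mulVec_testVec (L : D.CliqueLayering K w v₁ h)
    (hK : K.card = d) (hm : h v₁ ≤ m) (ht1 : 1 < t) (htd : 2 * d - 3 < t)
    (ht : (t + 1 - d) * (t + 4 - 2 * d) = d - 1 + (t ^ m)⁻¹)
    (heq : D.signlessLaplacian *ᵥ testVec t (t + 4 - 2 * d) w h =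
      (t + 1) • testVec t (t + 4 - 2 * d) w h) : D.IsTight K w v₁ h m := by
  classical
  have ht0 : 0 < t := by linarith
  have hpos : ∀ v, 0 < testVec t (t + 4 - 2 * d) w h v :=
    testVec_pos ht0 (by linarith) w h
  have hrow : ∀ v, ∑ u ∈ D.outNbrs v,
      (testVec t (t + 4 - 2 * d) w h v + testVec t (t + 4 - 2 * d) w h u) =
      (t + 1) * testVec t (t + 4 - 2 * d) w h v := fun v => by
    rw [← signlessLaplacian_mulVec, heq, Pi.smul_apply, smul_eq_mul]
  have hexit := sum_testVec_exit L.mem L.notMem L.eq_zero_iff hK ht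
  have hanti : (t ^ m)⁻¹ ≤ (t ^ h v₁)⁻¹ := inv_anti₀ (by positivity) (pow_le_pow_right₀ ht1.le hm)
  have hw := outNbrs_eq_of_le_sum hpos L.insert_subset_outNbrs (by rw [hexit]; linarith) (hrow w)
  refine ⟨fun v hv hvw => ?_, ?_, ?_, fun v hv => ?_⟩
  · convert (outNbrs_eq_of_le_sum hpos (L.erase_subset_outNbrs hv)
      (sum_testVec_of_mem L.mem L.eq_zero_iff hK hv hvw).ge (hrow v)).1
  · convert hw.1
  · have h1 := hw.2
    rw [hexit] at h1
    exact pow_right_injective₀ (by linarith) ht1.ne' (inv_injective (by linarith))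
  · obtain ⟨s, hvs, hs⟩ := L.exists_adj v hv
    have hsub : {s} ⊆ D.outNbrs v := by simpa using hvs
    have hsw : s ≠ w := by
      rintro rfl
      have hlt := testVec_add_exit (z := t + 4 - 2 * d) ht0 (by linarith)
        (L.ne_of_notMem hv) ((L.eq_zero_iff _).2 L.mem) hs
      have := (outNbrs_eq_of_le_sum hpos hsub
        (by rw [Finset.sum_singleton]; exact hlt.le) (hrow v)).2
      rw [Finset.sum_singleton] at this
      linarith
    refine ⟨s, hsw, hs, (outNbrs_eq_of_le_sum hpos hsub ?_ (hrow v)).1⟩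
    rw [Finset.sum_singleton]
    exact (testVec_add_of_ne (by linarith) (L.ne_of_notMem hv) hsw hs).ge

theorem Icc_subset_image [DecidableEq V] (L : D.CliqueLayering K w v₁ h) (v : V) :
    Finset.Icc 1 (h v) ⊆ (Finset.univ \ K).image h := fun k hk => by
  rw [Finset.mem_Icc] at hk
  obtain ⟨u, hu, rfl⟩ := L.exists_height_eq v k hk.1 hk.2
  exact Finset.mem_image_of_mem h (by simpa using hu)

theorem height_add_card_le (L : D.CliqueLayering K w v₁ h) (v : V) :
    h v + K.card ≤ Fintype.card V := by
  classical
  have h1 := (Finset.card_le_card (L.Icc_subset_image v)).trans Finset.card_image_le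
  have h2 := Finset.card_sdiff_add_card_eq_card (Finset.subset_univ K)
  rw [Nat.card_Icc] at h1
  rw [Finset.card_univ] at h2
  omega

/-- If the height of `v₁` is the number of vertices outside `K`, then these vertices have distinct
heights. -/
theorem injOn_height (L : D.CliqueLayering K w v₁ h)
    (hv₁ : h v₁ + K.card = Fintype.card V) : ∀ u ∉ K, ∀ v ∉ K, h u = h v → u = v := by
  classical
  have h2 := Finset.card_sdiff_add_card_eq_card (Finset.subset_univ K)
  rw [Finset.card_univ] at h2
  have hcard : ((Finset.univ \ K).image h).card = (Finset.univ \ K).card := by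
    refine le_antisymm Finset.card_image_le ?_
    have := Finset.card_le_card (L.Icc_subset_image v₁)
    rw [Nat.card_Icc] at this
    omega
  have := Finset.injOn_of_card_image_eq hcard
  exact fun u hu v hv huv => this (by simpa using hu) (by simpa using hv) huv

end CliqueLayering

/-- In a strongly connected digraph every clique that is neither empty nor everything has a
layering, by the distance to the clique. -/
theorem StronglyConnected.exists_cliqueLayering (hconn : D.StronglyConnected)
    (hK : D.IsClique K) (hne : K.Nonempty) (hlt : K.card < Fintype.card V) :
    ∃ w v₁ h, D.CliqueLayering K w v₁ h := by
  classical
  obtain ⟨b, hb⟩ := hne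
  obtain ⟨a, ha⟩ : ∃ a, a ∉ K := by
    by_contra! hall
    rw [Finset.eq_univ_of_forall hall, Finset.card_univ] at hlt
    exact lt_irrefl _ hlt
  obtain ⟨w, hw, v₁, hv₁, hadj⟩ : ∃ w ∈ K, ∃ v₁ ∉ K, D.Adj w v₁ := by
    by_contra! hno
    have : ∀ v, Relation.ReflTransGen D.Adj b v → v ∈ K := fun v hv => by
      induction hv with
      | refl => exact hb
      | tail _ hcd ih => exact by_contra fun hd => hno _ ih _ hd hcd
    exact ha (this a (hconn b a))
  -- `R k v` says that some walk of length `k` leads from `v` into `K`.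
  let R : ℕ → V → Prop := fun k =>
    Nat.rec (motive := fun _ => V → Prop) (· ∈ K) (fun _ P v => ∃ s, D.Adj v s ∧ P s) k
  have hR : ∀ v, ∃ k, R k v := fun v => by
    induction hconn v b using Relation.ReflTransGen.head_induction_on with
    | refl => exact ⟨0, hb⟩
    | head hab _ ih =>
      obtain ⟨k, hk⟩ := ih
      exact ⟨k + 1, _, hab, hk⟩
  refine ⟨w, v₁, fun v => Nat.find (hR v), hK, hw, hv₁, hadj, fun v => ?_, fun v hv => ?_⟩
  · exact Nat.find_eq_zero (hR v)
  · obtain ⟨k, hk⟩ : ∃ k, Nat.find (hR v) = k + 1 :=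
      Nat.exists_eq_succ_of_ne_zero fun h0 => hv ((Nat.find_eq_zero (hR v)).1 h0)
    have hspec := Nat.find_spec (hR v)
    rw [hk] at hspec
    obtain ⟨s, hvs, hs⟩ := hspec
    refine ⟨s, hvs, ?_⟩
    have h1 : Nat.find (hR s) ≤ k := Nat.find_min' _ hs
    have h2 : Nat.find (hR v) ≤ Nat.find (hR s) + 1 :=
      Nat.find_min' _ ⟨s, hvs, Nat.find_spec (hR s)⟩
    show Nat.find (hR s) + 1 = Nat.find (hR v)
    omega

theorem exists_isClique_card_eq (D : Digraph V) : ∃ K, D.IsClique K ∧ K.card = D.cliqueNum := by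
  classical
  obtain ⟨K, hK, h⟩ := Finset.exists_mem_eq_sup
    (Finset.univ.filter fun S : Finset V => D.IsClique S)
    ⟨∅, Finset.mem_filter.2 ⟨Finset.mem_univ _, fun u hu => absurd hu (Finset.notMem_empty u)⟩⟩
    Finset.card
  refine ⟨K, by simpa using hK, ?_⟩
  unfold cliqueNum
  convert h.symm

end Layering

/-! ### The digraph `B_{n,d}` and tight layerings -/

/-- The clique of `B_{n,d}`, with the arc `u_1 → u_2` leaving it and the distance along the path to
`u_{n-d+2}`, is a tight layering. -/
theorem B_exists_isTight (n d : ℕ) (hd : 2 ≤ d) (hdn : d + 1 ≤ n) :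
    ∃ K w v₁ h, (B n d).CliqueLayering K w v₁ h ∧ (B n d).IsTight K w v₁ h (n - d) ∧
      K.card = d := by
  classical
  set K : Finset (Fin n) := Finset.univ.filter fun i => i.val = 0 ∨ n + 1 ≤ i.val + d with hK
  have hmem : ∀ i, i ∈ K ↔ (i.val = 0 ∨ n + 1 ≤ i.val + d) := fun i => by simp [hK]
  refine ⟨K, ⟨0, by omega⟩, ⟨1, by omega⟩, fun i => if i.val = 0 then 0 else n + 1 - d - i.val,
    ⟨fun u hu v hv huv => ?_, ?_, ?_, ?_, fun v => ?_, fun v hv => ?_⟩,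
    ⟨fun v hv hv0 => ?_, ?_, ?_, fun v hv => ?_⟩, ?_⟩
  · rw [hmem] at hu hv
    exact Or.inl ⟨huv, hu, hv⟩
  · simp [hmem]
  · simp [hmem]; omega
  · exact Or.inr ⟨rfl, by simp; omega⟩
  · rw [hmem]
    split_ifs <;> omega
  · rw [hmem] at hv
    refine ⟨⟨v.val + 1, by omega⟩, Or.inr ⟨rfl, ?_⟩, ?_⟩
    · dsimp only; omega
    · rw [if_neg (Nat.succ_ne_zero _), if_neg (by omega)]
      dsimp only
      omega
  · ext u
    rw [hmem] at hv
    simp only [Ne, Fin.ext_iff] at hv0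
    simp only [mem_outNbrs, B, Finset.mem_erase, hmem, Ne, Fin.ext_iff]
    omega
  · ext u
    simp only [mem_outNbrs, B, Finset.mem_insert, Finset.mem_erase, hmem, Ne, Fin.ext_iff,
      true_or, true_and]
    omega
  · rw [if_neg one_ne_zero]
    dsimp only
    omega
  · rw [hmem] at hv
    refine ⟨⟨v.val + 1, by omega⟩, ?_, ?_, ?_⟩
    · simp [Fin.ext_iff]
    · rw [if_neg (Nat.succ_ne_zero _), if_neg (by omega)]
      dsimp only
      omega
    · ext u
      simp only [mem_outNbrs, B, Finset.mem_singleton, Ne, Fin.ext_iff]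
      omega
  · have h1 : K.map Fin.valEmbedding = insert 0 (Finset.Ico (n + 1 - d) n) := by
      ext k
      simp only [Finset.mem_map, hmem, Fin.valEmbedding_apply, Finset.mem_insert, Finset.mem_Ico]
      constructor
      · rintro ⟨i, hi, rfl⟩
        omega
      · intro hk
        exact ⟨⟨k, by omega⟩, by dsimp only; omega, rfl⟩
    rw [← Finset.card_map Fin.valEmbedding, h1, Finset.card_insert_of_notMem, Nat.card_Ico]
    · omega
    · rw [Finset.mem_Ico]; omega

/-- A tight layering with `n - d` vertices outside the clique determines the digraph. Those vertices
form a path, listed by decreasing height, from `w` to a clique vertex `e ≠ w`; the isomorphism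
sends `w` to `u_1`, the path and `e` to `u_2, …, u_{n-d+2}`, and the other clique vertices to the
remaining ones in any order. -/
theorem IsTight.nonempty_relIso {V : Type*} [Fintype V] {D : Digraph V} {K : Finset V} {w v₁ : V}
    {h : V → ℕ} {n d m : ℕ} (T : D.IsTight K w v₁ h m) (L : D.CliqueLayering K w v₁ h)
    (hd : 2 ≤ d) (hn : m + d = n) (hK : K.card = d) (hV : Fintype.card V = n) :
    Nonempty (D.Adj ≃r (B n d).Adj) := by
  classical
  have hinj := L.injOn_height (by rw [T.height_exit]; omega)
  have hle : ∀ v, h v ≤ m := fun v => by have := L.height_add_card_le v; omega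
  have hpos : ∀ v ∉ K, 1 ≤ h v := fun v hv =>
    Nat.one_le_iff_ne_zero.2 fun h0 => hv ((L.eq_zero_iff v).1 h0)
  have hall : ∀ k, 1 ≤ k → k ≤ m → ∃ u ∉ K, h u = k := fun k hk hkm =>
    L.exists_height_eq v₁ k hk (T.height_exit ▸ hkm)
  have hm1 : 1 ≤ m := T.height_exit ▸ hpos v₁ L.notMem
  obtain ⟨u₀, hu₀, hu₀1⟩ := hall 1 le_rfl hm1
  obtain ⟨e, hew, he, hNe⟩ := T.outNbrs_of_notMem u₀ hu₀
  have heK : e ∈ K := (L.eq_zero_iff e).1 (by omega)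
  -- The prescribed positions of `w`, of the vertices outside `K`, and of `e`; the value at the other
  -- vertices of `K` plays no role.
  set g : V → ℕ := fun v => if v = w then 0 else if v ∈ K then m + 1 else m + 1 - h v with hg
  have hgw : g w = 0 := by simp [hg]
  have hge : g e = m + 1 := by simp [hg, hew, heK]
  have hgK : ∀ v ∉ K, g v = m + 1 - h v := fun v hv => by
    simp only [hg, if_neg (L.ne_of_notMem hv), if_neg hv]
  have hgn : ∀ v, g v < n := fun v => by
    simp only [hg]; split_ifs <;> omega
  have hs : Set.InjOn (fun v => (⟨g v, hgn v⟩ : Fin n))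
      (↑(insert w (insert e (Finset.univ \ K))) : Set V) := by
    have key : ∀ v, v ∈ insert w (insert e (Finset.univ \ K)) ↔ v = w ∨ v = e ∨ v ∉ K := by simp
    intro a ha b hb hab
    rw [Finset.mem_coe, key] at ha hb
    have hab : g a = g b := congrArg Fin.val hab
    rcases ha with rfl | rfl | ha <;> rcases hb with rfl | rfl | hb
    · rfl
    · omega
    · have := hgK b hb; have := hle b; omega
    · omega
    · rfl
    · have := hgK b hb; have := hpos b hb; omega
    · have := hgK a ha; have := hle a; omega
    · have := hgK a ha; have := hpos a ha; omega
    · refine hinj a ha b hb ?_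
      have := hgK a ha; have := hle a; have := hgK b hb; have := hle b; omega
  obtain ⟨φ, hφ⟩ := Finset.exists_equiv_extend_of_card_eq
    (t := (Finset.univ : Finset (Fin n))) (by rw [hV]; simp) (Finset.subset_univ _) hs
  let ψ : V ≃ Fin n := φ.trans (Equiv.subtypeUnivEquiv fun i => Finset.mem_univ i)
  have hψ : ∀ v, v = w ∨ v = e ∨ v ∉ K → (ψ v).val = g v := fun v hv => by
    have := hφ v (by simpa using hv)
    exact congrArg Fin.val this
  have hψw : (ψ w).val = 0 := (hψ w (by simp)).trans hgw
  have hψe : (ψ e).val = m + 1 := (hψ e (by simp)).trans hge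
  have hψK : ∀ v ∉ K, (ψ v).val = m + 1 - h v := fun v hv => (hψ v (by simp [hv])).trans (hgK v hv)
  have hψv₁ : (ψ v₁).val = 1 := by rw [hψK v₁ L.notMem, T.height_exit]; omega
  have hψinj : ∀ u v, (ψ u).val = (ψ v).val ↔ u = v := fun u v => by
    rw [← Fin.ext_iff, ψ.apply_eq_iff_eq]
  -- The positions `0, …, m` are taken by `w` and the vertices outside `K`.
  have hψ' : ∀ v ∈ K, v ≠ w → m + 1 ≤ (ψ v).val := fun v hv hvw => by
    by_contra! hlt
    have h0 : (ψ v).val ≠ 0 := fun h0 => hvw ((hψinj v w).1 (h0.trans hψw.symm))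
    obtain ⟨u, hu, hhu⟩ := hall (m + 1 - (ψ v).val) (by omega) (by omega)
    have := (hψinj u v).1 (by rw [hψK u hu]; omega)
    exact hu (this ▸ hv)
  have hmem : ∀ v, ((ψ v).val = 0 ∨ n + 1 ≤ (ψ v).val + d) ↔ v ∈ K := fun v => by
    constructor
    · intro hv
      by_contra hvK
      have := hψK v hvK; have := hpos v hvK; have := hle v
      omega
    · intro hv
      by_cases hvw : v = w
      · exact Or.inl (hvw ▸ hψw)
      · have := hψ' v hv hvw
        omega
  refine ⟨⟨ψ, fun {u v} => ?_⟩⟩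
  simp only [B, hmem, Ne, ψ.apply_eq_iff_eq]
  rw [← D.mem_outNbrs]
  by_cases hu : u ∈ K
  · by_cases huw : u = w
    · subst huw
      rw [T.outNbrs_exit, Finset.mem_insert, Finset.mem_erase, hψw, ← hψinj v v₁, hψv₁, eq_comm]
      simp only [hu, true_and]
      constructor
      · rintro (⟨h1, h2⟩ | ⟨h1, -⟩)
        · exact Or.inr ⟨h1, h2⟩
        · exact Or.inl h1
      · rintro (h1 | ⟨h1, h2⟩)
        · exact Or.inr ⟨h1, by omega⟩
        · exact Or.inl ⟨h1, h2⟩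
    · have := hψ' u hu huw
      rw [T.outNbrs_of_mem u hu huw, Finset.mem_erase, eq_comm]
      simp only [hu, true_and]
      exact or_iff_left fun h' => by omega
  · obtain ⟨s, hsw, hs', hN⟩ := T.outNbrs_of_notMem u hu
    have h1 := hψK u hu
    have h2 := hpos u hu
    have h3 := hle u
    have hψs : (ψ s).val = (ψ u).val + 1 := by
      by_cases hsK : s ∈ K
      · have h0 := (L.eq_zero_iff s).2 hsK
        have huu : u = u₀ := hinj u hu u₀ hu₀ (by omega)
        subst huu
        have hse : s = e := Finset.singleton_injective (hN.symm.trans hNe)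
        rw [hse, hψe]; omega
      · rw [hψK s hsK]; omega
    rw [hN, Finset.mem_singleton, ← hψinj v s, hψs]
    simp only [hu, false_and, and_false, false_or]
    exact and_iff_left_of_imp fun h' => by omega

end Digraph

open Digraph Matrix in
theorem theorem4p2 (n d : ℕ) (hd : 2 ≤ d) (hdn : d + 1 ≤ n)
    {V : Type*} [Fintype V] (hV : Fintype.card V = n)
    (D : Digraph V) (hsimple : D.IsSimple) (hconn : D.StronglyConnected)
    (hclique : D.cliqueNum = d) :
    (Digraph.B n d).q ≤ D.q ∧
      (D.q = (Digraph.B n d).q ↔ Nonempty (D.Adj ≃r (Digraph.B n d).Adj)) := by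
  obtain ⟨t, htd, ht⟩ := exists_root d (n - d) hd
  have hd' : (2 : ℝ) ≤ d := by exact_mod_cast hd
  have ht1 : 1 < t := by linarith
  have hz : 0 < t + 4 - 2 * d := by linarith
  have hB : (B n d).q = t + 1 := by
    obtain ⟨K, w, v₁, h, L, T, hK⟩ := B_exists_isTight n d hd hdn
    have heq := L.mulVec_testVec_of_isTight T hK (by linarith) ht
    have : Nonempty (Fin n) := ⟨w⟩
    have hpos := testVec_pos (zero_lt_one.trans ht1) hz w h
    exact le_antisymm (q_le _ hpos heq.le)
      (le_q _ (fun v => (hpos v).le) (fun h0 => (hpos w).ne' (congrFun h0 w)) (by linarith) heq.ge)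
  obtain ⟨K, hKc, hK⟩ := D.exists_isClique_card_eq
  rw [hclique] at hK
  obtain ⟨w, v₁, h, L⟩ := hconn.exists_cliqueLayering hKc
    (Finset.card_pos.1 (by omega)) (by omega)
  have hm : h v₁ ≤ n - d := by have := L.height_add_card_le v₁; omega
  have hpos := testVec_pos (zero_lt_one.trans ht1) hz w h
  have hx : 0 ≤ testVec t (t + 4 - 2 * d) w h := fun v => (hpos v).le
  have hx0 : testVec t (t + 4 - 2 * d) w h ≠ 0 := fun h0 => (hpos w).ne' (congrFun h0 w)
  have hle := L.smul_testVec_le hK hm ht1 htd ht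
  rw [hB]
  refine ⟨D.le_q hx hx0 (by linarith) hle, fun hq => ?_, fun ⟨e⟩ => (q_eq_of_relIso e).trans hB⟩
  have hout : ∀ v, ∃ u, D.Adj v u := fun v => by
    have : Nontrivial V := Fintype.one_lt_card_iff_nontrivial.1 (by omega)
    obtain ⟨u, hu⟩ := exists_ne v
    obtain h' | ⟨b, hb, -⟩ := Relation.ReflTransGen.cases_head (hconn v u)
    · exact absurd h'.symm hu
    · exact ⟨b, hb⟩
  have heq : D.signlessLaplacian *ᵥ testVec t (t + 4 - 2 * d) w h =
      (t + 1) • testVec t (t + 4 - 2 * d) w h := by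
    by_contra hne
    exact (D.lt_q hconn hout hx hx0 (by linarith) hle hne).ne' hq
  exact (L.isTight_of_mulVec_testVec hK hm ht1 htd ht heq).nonempty_relIso L hd (by omega) hK hV
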